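/- Let $\Gamma=(V,E)$ be a finite simple graph and let $\mathcal A=\{(x,y),(y,x) : \{x,y\}\in E\}$ be its set of arcs; write $o(a)$, $t(a)$, $a^{-1}$ for the origin, terminus and inverse of an arc $a$. Define the matrices $d\in\mathbb C^{V\times\mathcal A}$ by $d_{x,a}=\frac{1}{\sqrt{\deg x}}\,\delta_{x,t(a)}$, $R\in\mathbb C^{\mathcal A\times\mathcal A}$ by $R_{a,b}=\delta_{a,b^{-1}}$, and $U=R(2d^*d-I)$ (the time evolution matrix of the Grover walk on $\Gamma$). A state is a vector $\Phi\in\mathbb C^{\mathcal A}$ with $\|\Phi\|=1$; it is of vertex type if $\Phi=d^*e_x$ for some $x\in V$, where $e_x$ is the standard unit vector at $x$. For distinct states $\Phi,\Psi$ and an integer $\tau\ge 1$, perfect state transfer occurs from $\Phi$ to $\Psi$ at time $\tau$ if $U^\tau\Phi=\gamma\Psi$ for some $\gamma\in\mathbb C$ with $|\gamma|=1$. The graph $\Gamma$ admits perfect state transfer if perfect state transfer occurs, at some time, between two distinct vertex type states. **Proposition.** Let $\Gamma$ be a connected $k$-regular graph whose adjacency matrix has set of distinct eigenvalues $\{k,\frac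 k2,-\frac k2,0\}$. If $\Gamma$ admits perfect state transfer, then the minimal time $\tau\ge 1$ at which perfect state transfer occurs between two distinct vertex type states of $\Gamma$ is either $6$ or $12$. Moreover, for every pair of distinct vertex type states $\Phi,\Psi$ such that perfect state transfer occurs from $\Phi$ to $\Psi$ at some time, the minimal time at which it occurs from $\Phi$ to $\Psi$ is either $6$ or $12$. -/

import Mathlib

open scoped Matrix

noncomputable section

namespace GroverWalk

variable {V : Type*} [Fintype V] [DecidableEq V] (G : SimpleGraph V) [DecidableRel G.Adj]

/-- The boundary matrix `d`: rows are vertices, columns are the symmetric arcs (darts) of `G`, and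
`d x a = 1 / √(deg x)` if `x` is the terminus of `a`, and `0` otherwise. -/
def boundaryMatrix : Matrix V G.Dart ℂ :=
  Matrix.of fun x a => if x = a.snd then ((1 / Real.sqrt (G.degree x) : ℝ) : ℂ) else 0

/-- The shift matrix `R`: `R a b = 1` if `a` is the inverse arc of `b`, and `0` otherwise. -/
def shiftMatrix : Matrix G.Dart G.Dart ℂ :=
  Matrix.of fun a b => if a = b.symm then 1 else 0

/-- The time evolution matrix `U = R (2 d* d - I)` of the Grover walk. -/
def timeEvolution : Matrix G.Dart G.Dart ℂ :=
  shiftMatrix G * ((2 : ℂ) • ((boundaryMatrix G)ᴴ * boundaryMatrix G) - 1)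

/-- A state is a vector on the arcs of Euclidean (ℓ²) norm one. -/
def IsState (Φ : G.Dart → ℂ) : Prop :=
  ‖WithLp.toLp 2 Φ‖ = 1

/-- A state is of vertex type if it is `d* e_x` for some vertex `x`. -/
def IsVertexTypeState (Φ : G.Dart → ℂ) : Prop :=
  IsState G Φ ∧ ∃ x : V, Φ = (boundaryMatrix G)ᴴ *ᵥ Pi.single x 1

/-- Perfect state transfer from the state `Φ` to the distinct state `Ψ` at time `τ ≥ 1`. -/
def PSTOccurs (Φ Ψ : G.Dart → ℂ) (τ : ℕ) : Prop :=
  IsState G Φ ∧ IsState G Ψ ∧ Φ ≠ Ψ ∧ 1 ≤ τ ∧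
    ∃ γ : ℂ, ‖γ‖ = 1 ∧ (timeEvolution G ^ τ) *ᵥ Φ = γ • Ψ

/-- The times at which perfect state transfer occurs between two distinct vertex type states. -/
def pstTimes : Set ℕ :=
  {τ | ∃ Φ Ψ : G.Dart → ℂ, IsVertexTypeState G Φ ∧ IsVertexTypeState G Ψ ∧ PSTOccurs G Φ Ψ τ}

/-- `G` admits perfect state transfer if it occurs, at some time, between two distinct
vertex type states. -/
def AdmitsPST : Prop :=
  ∃ Φ Ψ : G.Dart → ℂ, IsVertexTypeState G Φ ∧ IsVertexTypeState G Ψ ∧ ∃ τ : ℕ, PSTOccurs G Φ Ψ τ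

end GroverWalk

end

/-!
Let `P = d R d*` be the discriminant of the walk. As `d* d` is a projection and `R` an involution,
`d U ^ n d*` is the Chebyshev polynomial `T_n` at `P`, and transfer from `x` to `y` at time `n`
amounts to `T_n(P) e_x = γ e_y`.

The functional `L p = (p(P))_{x x}` is nonnegative on polynomials that are nonnegative on the
spectrum `{1, 1/2, -1/2, 0}` of `P`, and positive if moreover `p 1 > 0`, because the eigenvector
`(√deg)` for the eigenvalue `1` does not vanish at `x`. Transfer at time `n` gives `L T_n = 0` and
`L (T_n ^ 2) = 1`, while `L X = 0` because the graph has no loops. Three polynomials then determine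
`n` modulo `12`:
* `1 - T_n ^ 2 + X`, which is nonnegative on the spectrum if `3 ∤ n`, forces `3 ∣ n`;
* `T_n + 2 X`, which is nonnegative on the spectrum if `3 ∣ n` and `n` is odd, forces `2 ∣ n`;
* `T_n`, which is `1` on the whole spectrum if `12 ∣ n`, excludes `12 ∣ n`.
So `n` is an odd multiple of `6`. Then `T_n` and `T_6` agree on the spectrum, and transfer occurs at
time `6` already.
-/

namespace GroverWalk

open Polynomial Polynomial.Chebyshev

section Chebyshev

theorem eval_T_mul_of_odd {R : Type*} [CommRing R] {c : R} {m j : ℤ} (hj : Odd j)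
    (hc : (T R m).eval c = 1 ∨ (T R m).eval c = -1) :
    (T R (j * m)).eval c = (T R m).eval c := by
  rw [T_mul, eval_comp]
  rcases hc with hc | hc <;> simp [hc, Int.negOnePow_odd j hj]

variable {F : Type*} [Field F] [NeZero (2 : F)]

theorem periodic_eval_T_neg_half : Function.Periodic (fun n : ℤ => (T F n).eval (-2⁻¹)) 3 := by
  have recurrence (n : ℤ) : (T F (n + 2)).eval (-2⁻¹) =
      -(T F (n + 1)).eval (-2⁻¹) - (T F n).eval (-2⁻¹) := by
    simp only [T_add_two, eval_sub, eval_mul, eval_ofNat, eval_X]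
    field_simp
  intro n
  have h := recurrence (n + 1)
  rw [add_assoc, add_assoc, one_add_one_eq_two, recurrence n] at h
  simpa [show (1 : ℤ) + 2 = 3 from rfl] using h

theorem eval_T_neg_half (n : ℤ) : (T F n).eval (-2⁻¹) = if 3 ∣ n then 1 else -2⁻¹ := by
  have hmod := periodic_eval_T_neg_half (F := F).int_mul (n / 3) (n % 3)
  simp only [Int.cast_id, mul_comm (n / 3), Int.emod_add_mul_ediv] at hmod
  rw [hmod]
  have hlt := Int.emod_lt_of_pos n (by norm_num : (0 : ℤ) < 3)
  have hnonneg := Int.emod_nonneg n (by norm_num : (3 : ℤ) ≠ 0)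
  simp only [Int.dvd_iff_emod_eq_zero]
  interval_cases n % 3
  · simp
  · simp
  · have htwo : (2 : F) * 2⁻¹ = 1 := mul_inv_cancel₀ two_ne_zero
    simp only [T_two, eval_sub, eval_mul, eval_ofNat, eval_pow, eval_X, eval_one,
      OfNat.ofNat_ne_zero, if_false]
    linear_combination (2⁻¹ + 1) * htwo

theorem eval_T_half (n : ℤ) :
    (T F n).eval 2⁻¹ = n.negOnePow * if 3 ∣ n then 1 else -2⁻¹ := by
  rw [← eval_T_neg_half, ← T_eval_neg, neg_neg]

end Chebyshev

section MatrixPolynomial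

variable {m n : Type*} [Fintype m] [DecidableEq m] [Fintype n] [DecidableEq n]

theorem aeval_mulVec_of_mulVec_eq_smul {R S : Type*} [CommSemiring R] [CommSemiring S] [Algebra R S]
    {P : Matrix n n S} {v : n → S} {c : R} (h : P *ᵥ v = c • v) (p : R[X]) :
    aeval P p *ᵥ v = p.eval c • v := by
  have hpow (k : ℕ) : P ^ k *ᵥ v = c ^ k • v := by
    induction k with
    | zero => simp
    | succ k ih =>
      rw [pow_succ, ← Matrix.mulVec_mulVec, h, Matrix.mulVec_smul, ih, smul_smul, pow_succ']
  induction p using Polynomial.induction_on' with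
  | add p q hp hq => rw [map_add, Matrix.add_mulVec, hp, hq, eval_add, add_smul]
  | monomial k a =>
    rw [aeval_monomial, eval_monomial, ← Algebra.smul_def, Matrix.smul_mulVec, hpow, smul_smul]

theorem mul_pow_mul_eq_aeval_T_mul {R S : Type*} [CommRing R] [CommRing S] [Algebra R S]
    {C : Matrix n m S} {D : Matrix m n S} {E : Matrix m m S} (hCDC : C * D * C = C)
    (hDCD : D * C * D = D) (hE : E * E = 1) (k : ℕ) :
    C * (E * ((2 : S) • (D * C) - 1)) ^ k * D = aeval (C * E * D) (T R k) * (C * D) := by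
  set U := E * ((2 : S) • (D * C) - 1) with hU
  have hUD : U * D = E * D := by
    rw [hU, Matrix.mul_assoc, Matrix.sub_mul, Matrix.smul_mul, hDCD]
    simp [two_smul]
  have hCU : C * U = (2 : S) • (C * E * D * C) - C * E := by
    simp only [hU, Matrix.mul_sub, Matrix.mul_smul, Matrix.mul_one, Matrix.mul_assoc]
  have hCEU : C * E * U = C := by
    rw [hU, Matrix.mul_assoc, ← Matrix.mul_assoc E, hE, Matrix.one_mul, Matrix.mul_sub,
      Matrix.mul_smul, ← Matrix.mul_assoc, hCDC, Matrix.mul_one, two_smul, add_sub_cancel_right]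
  have hCUU : C * U * U = (2 : S) • (C * E * D * (C * U)) - C := by
    conv_lhs => rw [hCU]
    rw [Matrix.sub_mul, hCEU, Matrix.smul_mul, Matrix.mul_assoc _ C]
  induction k using Nat.twoStepInduction with
  | zero => simp
  | one =>
    simp only [pow_one, Nat.cast_one, T_one, aeval_X]
    rw [Matrix.mul_assoc C, hUD, Matrix.mul_assoc _ D, ← Matrix.mul_assoc D, hDCD, Matrix.mul_assoc]
  | more k ih ih' =>
    have hpow : C * U ^ (k + 2) * D = 2 * (C * E * D * (C * U ^ (k + 1) * D)) - C * U ^ k * D := by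
      calc C * U ^ (k + 2) * D = C * U * U * (U ^ k * D) := by
            simp only [pow_succ', Matrix.mul_assoc]
        _ = _ := by
            simp only [hCUU, two_mul, two_smul, Matrix.sub_mul, Matrix.add_mul, pow_succ',
              Matrix.mul_assoc]
    push_cast at ih' ⊢
    rw [hpow, ih, ih', T_add_two, map_sub, map_mul, map_mul, aeval_X, map_ofNat, Matrix.sub_mul]
    simp only [Matrix.mul_assoc]

end MatrixPolynomial

section Hermitian

variable {n 𝕜 : Type*} [Fintype n] [DecidableEq n] [RCLike 𝕜] {P : Matrix n n 𝕜}

theorem isHermitian_aeval (hP : P.IsHermitian) (p : ℝ[X]) : (aeval P p).IsHermitian := by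
  rw [← cfc_polynomial p P hP]
  exact cfc_predicate _ P

open scoped ComplexOrder MatrixOrder in
theorem posSemidef_aeval (hP : P.IsHermitian) {p : ℝ[X]}
    (hp : ∀ c ∈ spectrum ℝ P, 0 ≤ p.eval c) : (aeval P p).PosSemidef := by
  rw [← Matrix.nonneg_iff_posSemidef, ← cfc_polynomial p P hP]
  exact cfc_nonneg hp

theorem aeval_congr_of_spectrum (hP : P.IsHermitian) {p q : ℝ[X]}
    (hpq : ∀ c ∈ spectrum ℝ P, p.eval c = q.eval c) : aeval P p = aeval P q := by
  rw [← cfc_polynomial p P hP, ← cfc_polynomial q P hP]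
  exact cfc_congr hpq

open scoped ComplexOrder in
theorem aeval_apply_self_ne_zero (hP : P.IsHermitian) {p : ℝ[X]}
    (hp : ∀ c ∈ spectrum ℝ P, 0 ≤ p.eval c) {c : ℝ} (hc : p.eval c ≠ 0) {v : n → 𝕜}
    (hv : P *ᵥ v = c • v) {x : n} (hx : v x ≠ 0) : aeval P p x x ≠ 0 := by
  intro h0
  -- A positive semidefinite matrix with a vanishing diagonal entry has a vanishing row.
  have hcol : aeval P p *ᵥ Pi.single x 1 = 0 :=
    ((posSemidef_aeval hP hp).dotProduct_mulVec_zero_iff _).mp (by simpa using h0)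
  have hrow (z : n) : aeval P p x z = 0 := by
    rw [← (isHermitian_aeval hP p).apply x z]
    simpa using congrFun hcol z
  have hvx : (aeval P p *ᵥ v) x = p.eval c • v x := by
    rw [aeval_mulVec_of_mulVec_eq_smul hv, Pi.smul_apply]
  refine smul_ne_zero hc hx (hvx.symm.trans ?_)
  simp [Matrix.mulVec, dotProduct, hrow]

theorem apply_self_mul_self_of_mulVec_single {M : Matrix n n 𝕜} (hM : M.IsHermitian)
    {x y : n} {γ : 𝕜} (hγ : ‖γ‖ = 1)
    (h : M *ᵥ Pi.single x 1 = γ • Pi.single y 1) : (M * M) x x = 1 := by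
  have hcol (z : n) : M z x = if z = y then γ else 0 := by
    simpa [Pi.single_apply] using congrFun h z
  have hrow (z : n) : M x z = if z = y then star γ else 0 := by
    rw [← hM.apply, hcol, apply_ite star, star_zero]
  simp [Matrix.mul_apply, hcol, hrow, RCLike.conj_mul, hγ]

end Hermitian

section ArithmeticConstraint

variable {n 𝕜 : Type*} [Fintype n] [DecidableEq n] [RCLike 𝕜] {P : Matrix n n 𝕜}
  (hP : P.IsHermitian) (hspec : spectrum ℝ P ⊆ {1, 2⁻¹, -2⁻¹, 0})
include hP hspec

theorem aeval_T_odd_mul_six {j : ℤ} (hj : Odd j) : aeval P (T ℝ (j * 6)) = aeval P (T ℝ 6) := by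
  refine aeval_congr_of_spectrum hP fun c hc => eval_T_mul_of_odd hj ?_
  rcases hspec hc with rfl | rfl | rfl | rfl
  · simp
  · exact .inl (by simp only [eval_T_half, Int.negOnePow_even 6 (by decide)]; norm_num)
  · exact .inl (by rw [eval_T_neg_half, if_pos (by norm_num)])
  · exact .inr (by
      rw [T_eval_zero_of_even (R := ℝ) (n := 6) (by decide), Int.negOnePow_odd _ (by decide)]; simp)

variable {v : n → 𝕜} (hv : P *ᵥ v = v) {x : n} (hx : v x ≠ 0)
include hv hx

theorem aeval_apply_self_ne_zero_of_eval_nonneg {p : ℝ[X]} (h_one : 0 < p.eval 1)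
    (h_half : 0 ≤ p.eval 2⁻¹) (h_neg_half : 0 ≤ p.eval (-2⁻¹)) (h_zero : 0 ≤ p.eval 0) :
    aeval P p x x ≠ 0 := by
  refine aeval_apply_self_ne_zero hP (fun c hc => ?_) h_one.ne' (by rwa [one_smul]) hx
  rcases hspec hc with rfl | rfl | rfl | rfl
  exacts [h_one.le, h_half, h_neg_half, h_zero]

variable {k : ℤ}

theorem three_dvd_of_aeval_T_sq_apply_self (hxx : P x x = 0)
    (hsq : aeval P (T ℝ k ^ 2) x x = 1) : 3 ∣ k := by
  by_contra h3
  have hne : aeval P (1 - T ℝ k ^ 2 + X) x x ≠ 0 := by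
    apply aeval_apply_self_ne_zero_of_eval_nonneg hP hspec hv hx
    · simp
    · simp only [eval_add, eval_sub, eval_pow, eval_one, eval_X, eval_T_half, if_neg h3]
      rcases Int.even_or_odd k with hk | hk <;> norm_num [hk]
    · simp only [eval_add, eval_sub, eval_pow, eval_one, eval_X, eval_T_neg_half, if_neg h3]
      norm_num
    · rcases Int.even_or_odd k with hk | hk
      · simp [T_eval_zero_of_even, hk]
      · simp [T_eval_zero_of_odd, hk]
  apply hne
  simp only [map_add, map_sub, map_one, aeval_X, Matrix.add_apply, Matrix.sub_apply,
    Matrix.one_apply_eq, hsq, hxx, sub_self, add_zero]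

theorem even_of_aeval_T_apply_self (h3 : 3 ∣ k) (hxx : P x x = 0)
    (h0 : aeval P (T ℝ k) x x = 0) : Even k := by
  by_contra hk
  rw [Int.not_even_iff_odd] at hk
  have hne : aeval P (T ℝ k + 2 * X) x x ≠ 0 := by
    apply aeval_apply_self_ne_zero_of_eval_nonneg hP hspec hv hx
    · norm_num
    · simp [eval_T_half, h3, hk]
    · simp [eval_T_neg_half, h3, -T_eval_neg]
    · simp [T_eval_zero_of_odd, hk]
  apply hne
  simp [two_mul, h0, hxx]

theorem not_twelve_dvd_of_aeval_T_apply_self (h0 : aeval P (T ℝ k) x x = 0) : ¬12 ∣ k := by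
  intro h12
  have h3 : 3 ∣ k := by omega
  have heven : Even k := by grind
  have heven_half : Even (k / 2) := by grind
  refine aeval_apply_self_ne_zero_of_eval_nonneg hP hspec hv hx ?_ ?_ ?_ ?_ h0
  · simp
  · simp [eval_T_half, h3, heven]
  · simp [eval_T_neg_half, h3, -T_eval_neg]
  · simp [T_eval_zero_of_even, heven, heven_half]

theorem exists_odd_mul_six_of_aeval_T_mulVec_single (hxx : P x x = 0) {y : n} (hxy : x ≠ y) {γ : 𝕜}
    (hγ : ‖γ‖ = 1) (h : aeval P (T ℝ k) *ᵥ Pi.single x 1 = γ • Pi.single y 1) :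
    ∃ j : ℤ, Odd j ∧ k = j * 6 := by
  have h0 : aeval P (T ℝ k) x x = 0 := by simpa [hxy] using congrFun h x
  have hsq : aeval P (T ℝ k ^ 2) x x = 1 := by
    rw [sq, map_mul]
    exact apply_self_mul_self_of_mulVec_single (isHermitian_aeval hP _) hγ h
  have h3 := three_dvd_of_aeval_T_sq_apply_self hP hspec hv hx hxx hsq
  have h2 := even_of_aeval_T_apply_self hP hspec hv hx h3 hxx h0
  have h12 := not_twelve_dvd_of_aeval_T_apply_self hP hspec hv hx h0
  exact ⟨k / 6, by grind, by grind⟩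

end ArithmeticConstraint

section PartialIsometry

variable {m n R : Type*} [Fintype m] [Fintype n] [Ring R] [PartialOrder R] [StarRing R]
  [StarOrderedRing R] [NoZeroDivisors R] {C : Matrix m n R}

theorem conjTranspose_mulVec_mulVec_of_dotProduct_eq (hC : C * Cᴴ * C = C) {u : n → R}
    (hu : star (C *ᵥ u) ⬝ᵥ (C *ᵥ u) = star u ⬝ᵥ u) : Cᴴ *ᵥ (C *ᵥ u) = u := by
  have hproj : C *ᵥ (Cᴴ *ᵥ (C *ᵥ u)) = C *ᵥ u := by
    simp only [Matrix.mulVec_mulVec, ← Matrix.mul_assoc, hC]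
  have hu' : star u ⬝ᵥ (Cᴴ *ᵥ (C *ᵥ u)) = star u ⬝ᵥ u := by
    rw [← hu, Matrix.star_mulVec, Matrix.dotProduct_mulVec]
  have hcross : star (Cᴴ *ᵥ (C *ᵥ u)) ⬝ᵥ u = star u ⬝ᵥ u := by
    rw [← hu, Matrix.star_mulVec, Matrix.conjTranspose_conjTranspose, Matrix.dotProduct_mulVec]
  have hself : star (Cᴴ *ᵥ (C *ᵥ u)) ⬝ᵥ (Cᴴ *ᵥ (C *ᵥ u)) = star u ⬝ᵥ u := by
    rw [Matrix.star_mulVec, Matrix.conjTranspose_conjTranspose, ← Matrix.dotProduct_mulVec, hproj,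
      hu]
  rw [← sub_eq_zero, ← dotProduct_star_self_eq_zero]
  rw [star_sub, sub_dotProduct, dotProduct_sub, dotProduct_sub, hself, hcross, hu', sub_self]

end PartialIsometry

section Shift

variable {V : Type*} [DecidableEq V] (G : SimpleGraph V)

omit [DecidableEq V] in
variable {G} in
theorem dart_eq_symm_comm {a b : G.Dart} : a = b.symm ↔ b = a.symm :=
  eq_comm.trans SimpleGraph.Dart.symm_involutive.eq_iff

theorem isHermitian_shiftMatrix : (shiftMatrix G).IsHermitian := by
  ext a b
  simp [shiftMatrix, dart_eq_symm_comm (a := b), apply_ite]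

variable [Fintype V] [DecidableRel G.Adj]

theorem shiftMatrix_mul_apply {ι : Type*} (M : Matrix G.Dart ι ℂ) (a : G.Dart) (i : ι) :
    (shiftMatrix G * M) a i = M a.symm i := by
  simp [Matrix.mul_apply, shiftMatrix, dart_eq_symm_comm (a := a)]

theorem shiftMatrix_mul_self : shiftMatrix G * shiftMatrix G = 1 := by
  ext a b
  rw [shiftMatrix_mul_apply]
  simp [shiftMatrix, Matrix.one_apply, SimpleGraph.Dart.symm_involutive.injective.eq_iff]

end Shift

section Walk

theorem inv_sqrt_mul_inv_sqrt (k : ℕ) : ((√k : ℝ) : ℂ)⁻¹ * ((√k : ℝ) : ℂ)⁻¹ = (k : ℂ)⁻¹ := by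
  rw [← mul_inv, ← Complex.ofReal_mul, Real.mul_self_sqrt k.cast_nonneg, Complex.ofReal_natCast]

variable {V : Type*} [Fintype V] [DecidableEq V] (G : SimpleGraph V) [DecidableRel G.Adj]

theorem card_filter_dart_snd_eq (x : V) :
    (Finset.univ.filter fun a : G.Dart => a.snd = x).card = G.degree x := by
  rw [← G.dart_fst_fiber_card_eq_degree x]
  refine Finset.card_nbij' SimpleGraph.Dart.symm SimpleGraph.Dart.symm ?_ ?_ ?_ ?_ <;>
    intro a <;> simp

theorem boundaryMatrix_mul_conjTranspose :
    boundaryMatrix G * (boundaryMatrix G)ᴴ =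
      Matrix.diagonal fun x => if G.degree x = 0 then 0 else 1 := by
  ext x y
  have hterm (a : G.Dart) : boundaryMatrix G x a * (boundaryMatrix G)ᴴ a y =
      if a.snd = x then (if x = y then (G.degree x : ℂ)⁻¹ else 0) else 0 := by
    by_cases hx : a.snd = x <;> by_cases hxy : x = y
    · subst hxy
      simp [boundaryMatrix, hx, inv_sqrt_mul_inv_sqrt]
    · simp [boundaryMatrix, hx, hxy, Ne.symm hxy]
    all_goals simp [boundaryMatrix, hx, Ne.symm hx]
  rw [Matrix.mul_apply, Finset.sum_congr rfl fun a _ => hterm a, ← Finset.sum_filter,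
    Finset.sum_const, card_filter_dart_snd_eq, Matrix.diagonal_apply]
  split_ifs <;> simp_all

theorem boundaryMatrix_mul_conjTranspose_mul_self :
    boundaryMatrix G * (boundaryMatrix G)ᴴ * boundaryMatrix G = boundaryMatrix G := by
  ext x a
  rw [boundaryMatrix_mul_conjTranspose, Matrix.diagonal_mul]
  by_cases hx : G.degree x = 0
  · simp [boundaryMatrix, hx]
  · simp [hx]

theorem boundaryMatrix_conjTranspose_mul_self_mul :
    (boundaryMatrix G)ᴴ * boundaryMatrix G * (boundaryMatrix G)ᴴ = (boundaryMatrix G)ᴴ := by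
  simpa [Matrix.mul_assoc] using
    congrArg Matrix.conjTranspose (boundaryMatrix_mul_conjTranspose_mul_self G)

variable {G} in
theorem boundaryMatrix_mulVec_conjTranspose_single {x : V} (hx : G.degree x ≠ 0) :
    boundaryMatrix G *ᵥ ((boundaryMatrix G)ᴴ *ᵥ Pi.single x 1) = Pi.single x 1 := by
  ext y
  rw [Matrix.mulVec_mulVec, boundaryMatrix_mul_conjTranspose, Matrix.mulVec_single_one]
  by_cases hxy : y = x
  · simp [hxy, hx]
  · simp [hxy]

theorem timeEvolution_mem_unitary : timeEvolution G ∈ unitary (Matrix G.Dart G.Dart ℂ) := by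
  have hshift : shiftMatrix G ∈ unitary (Matrix G.Dart G.Dart ℂ) := by
    simp only [Unitary.mem_iff, Matrix.star_eq_conjTranspose, (isHermitian_shiftMatrix G).eq,
      shiftMatrix_mul_self, and_self]
  have hproj : IsStarProjection ((boundaryMatrix G)ᴴ * boundaryMatrix G) :=
    ⟨by rw [IsIdempotentElem, ← Matrix.mul_assoc, boundaryMatrix_conjTranspose_mul_self_mul],
      Matrix.isHermitian_conjTranspose_mul_self _⟩
  rw [timeEvolution, ofNat_smul_eq_nsmul, nsmul_eq_mul]
  exact mul_mem hshift hproj.two_mul_sub_one_mem_unitary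

/-- The discriminant `d R d*` of the Grover walk: the compression of the walk to the vertices, which
is the normalized adjacency matrix of the graph. -/
noncomputable def discriminant : Matrix V V ℂ :=
  boundaryMatrix G * shiftMatrix G * (boundaryMatrix G)ᴴ

theorem isHermitian_discriminant : (discriminant G).IsHermitian := by
  rw [discriminant]
  exact Matrix.isHermitian_mul_mul_conjTranspose _ (isHermitian_shiftMatrix G)

theorem discriminant_apply (x y : V) :
    discriminant G x y =
      if G.Adj x y then ((√(G.degree x) : ℝ) : ℂ)⁻¹ * ((√(G.degree y) : ℝ) : ℂ)⁻¹ else 0 := by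
  have hterm (a : G.Dart) : boundaryMatrix G x a * (shiftMatrix G * (boundaryMatrix G)ᴴ) a y =
      if x = a.snd ∧ y = a.fst then ((√(G.degree x) : ℝ) : ℂ)⁻¹ * ((√(G.degree y) : ℝ) : ℂ)⁻¹
      else 0 := by
    rw [shiftMatrix_mul_apply, Matrix.conjTranspose_apply]
    by_cases hx : x = a.snd
    · by_cases hy : y = a.fst
      · subst hx hy
        simp [boundaryMatrix]
      · simp [boundaryMatrix, hy]
    · simp [boundaryMatrix, hx]
  rw [discriminant, Matrix.mul_assoc, Matrix.mul_apply, Finset.sum_congr rfl fun a _ => hterm a]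
  split_ifs with hadj
  · rw [Finset.sum_eq_single ⟨(y, x), hadj.symm⟩ ?_ (by simp)]
    · simp
    · rintro a - ha
      exact if_neg fun ⟨hx, hy⟩ => ha (by subst hx hy; rfl)
  · refine Finset.sum_eq_zero fun a _ => if_neg ?_
    rintro ⟨rfl, rfl⟩
    exact hadj a.adj.symm

theorem discriminant_mulVec_sqrt_degree :
    discriminant G *ᵥ (fun x => ((√(G.degree x) : ℝ) : ℂ)) =
      fun x => ((√(G.degree x) : ℝ) : ℂ) := by
  ext x
  have hterm (y : V) : discriminant G x y * ((√(G.degree y) : ℝ) : ℂ) =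
      if G.Adj x y then ((√(G.degree x) : ℝ) : ℂ)⁻¹ else 0 := by
    rw [discriminant_apply]
    split_ifs with hadj
    · have hy : ((√(G.degree y) : ℝ) : ℂ) ≠ 0 := by
        simpa using (G.degree_pos_iff_exists_adj y).mpr ⟨x, hadj.symm⟩ |>.ne'
      rw [mul_assoc, inv_mul_cancel₀ hy, mul_one]
    · rw [zero_mul]
  simp only [Matrix.mulVec, dotProduct, hterm]
  rw [← Finset.sum_filter, Finset.sum_const, ← G.neighborFinset_eq_filter,
    G.card_neighborFinset_eq_degree, nsmul_eq_mul, ← div_eq_mul_inv,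
    ← Complex.ofReal_natCast, ← Complex.ofReal_div, Real.div_sqrt]

variable {G} {x y : V}

theorem boundaryMatrix_mulVec_timeEvolution_pow_mulVec (hx : G.degree x ≠ 0) (n : ℕ) :
    boundaryMatrix G *ᵥ (timeEvolution G ^ n *ᵥ ((boundaryMatrix G)ᴴ *ᵥ Pi.single x 1)) =
      aeval (discriminant G) (T ℝ n) *ᵥ Pi.single x 1 := by
  rw [Matrix.mulVec_mulVec, Matrix.mulVec_mulVec, timeEvolution,
    mul_pow_mul_eq_aeval_T_mul (R := ℝ) (boundaryMatrix_mul_conjTranspose_mul_self G)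
      (boundaryMatrix_conjTranspose_mul_self_mul G) (shiftMatrix_mul_self G),
    ← discriminant, ← Matrix.mulVec_mulVec, ← Matrix.mulVec_mulVec,
    boundaryMatrix_mulVec_conjTranspose_single hx]

theorem star_timeEvolution_pow_mulVec_dotProduct_self (hx : G.degree x ≠ 0) (n : ℕ) :
    star (timeEvolution G ^ n *ᵥ ((boundaryMatrix G)ᴴ *ᵥ Pi.single x 1)) ⬝ᵥ
      (timeEvolution G ^ n *ᵥ ((boundaryMatrix G)ᴴ *ᵥ Pi.single x 1)) = 1 := by
  have hunitary : (timeEvolution G ^ n)ᴴ * timeEvolution G ^ n = 1 :=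
    (Unitary.mem_iff.mp (pow_mem (timeEvolution_mem_unitary G) n)).1
  rw [Matrix.star_mulVec, ← Matrix.dotProduct_mulVec, Matrix.mulVec_mulVec, hunitary,
    Matrix.one_mulVec, Matrix.star_mulVec, ← Matrix.dotProduct_mulVec,
    Matrix.conjTranspose_conjTranspose, boundaryMatrix_mulVec_conjTranspose_single hx]
  simp

open scoped ComplexOrder in
theorem timeEvolution_pow_mulVec_eq_smul_iff (hx : G.degree x ≠ 0) (hy : G.degree y ≠ 0)
    {γ : ℂ} (hγ : ‖γ‖ = 1) (n : ℕ) :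
    timeEvolution G ^ n *ᵥ ((boundaryMatrix G)ᴴ *ᵥ Pi.single x 1) =
        γ • ((boundaryMatrix G)ᴴ *ᵥ Pi.single y 1) ↔
      aeval (discriminant G) (T ℝ n) *ᵥ Pi.single x 1 = γ • Pi.single y 1 := by
  rw [← boundaryMatrix_mulVec_timeEvolution_pow_mulVec hx]
  constructor
  · intro h
    rw [h, Matrix.mulVec_smul, boundaryMatrix_mulVec_conjTranspose_single hy]
  · intro h
    rw [← Matrix.mulVec_smul, ← h, conjTranspose_mulVec_mulVec_of_dotProduct_eq
        (boundaryMatrix_mul_conjTranspose_mul_self G)]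
    rw [star_timeEvolution_pow_mulVec_dotProduct_self hx, h]
    simp [Complex.mul_conj', hγ]

end Walk

section PerfectStateTransfer

variable {V : Type*} [Fintype V] [DecidableEq V] {G : SimpleGraph V} [DecidableRel G.Adj]

theorem degree_ne_zero_of_isState {x : V}
    (h : IsState G ((boundaryMatrix G)ᴴ *ᵥ Pi.single x 1)) : G.degree x ≠ 0 := by
  intro hx
  have hzero : (boundaryMatrix G)ᴴ *ᵥ Pi.single x 1 = 0 := by
    ext a
    simp [boundaryMatrix, hx]
  rw [IsState, hzero, WithLp.toLp_zero, norm_zero] at h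
  exact zero_ne_one h

theorem six_le_and_pstOccurs_six
    (hspec : spectrum ℝ (discriminant G) ⊆ {1, 2⁻¹, -2⁻¹, 0}) {Φ Ψ : G.Dart → ℂ} {τ : ℕ}
    (hΦ : IsVertexTypeState G Φ) (hΨ : IsVertexTypeState G Ψ) (h : PSTOccurs G Φ Ψ τ) :
    6 ≤ τ ∧ PSTOccurs G Φ Ψ 6 := by
  obtain ⟨hstateΦ, x, rfl⟩ := hΦ
  obtain ⟨hstateΨ, y, rfl⟩ := hΨ
  obtain ⟨-, -, hne, hτ, γ, hγ, htransfer⟩ := h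
  have hx := degree_ne_zero_of_isState hstateΦ
  have hy := degree_ne_zero_of_isState hstateΨ
  rw [timeEvolution_pow_mulVec_eq_smul_iff hx hy hγ] at htransfer
  obtain ⟨j, hj, hjτ⟩ := exists_odd_mul_six_of_aeval_T_mulVec_single (isHermitian_discriminant G)
    hspec (discriminant_mulVec_sqrt_degree G) (x := x) (by simpa using hx)
    (by simp [discriminant_apply]) (by rintro rfl; exact hne rfl) hγ htransfer
  refine ⟨by omega, hstateΦ, hstateΨ, hne, by norm_num, γ, hγ, ?_⟩
  rw [timeEvolution_pow_mulVec_eq_smul_iff hx hy hγ, Nat.cast_ofNat,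
    ← aeval_T_odd_mul_six (isHermitian_discriminant G) hspec hj, ← hjτ, htransfer]

end PerfectStateTransfer

section Regular

variable {V : Type*} [Fintype V] [DecidableEq V] {G : SimpleGraph V} [DecidableRel G.Adj] {k : ℕ}

theorem discriminant_eq_smul_adjMatrix (hreg : G.IsRegularOfDegree k) :
    discriminant G = (k : ℂ)⁻¹ • G.adjMatrix ℂ := by
  ext x y
  simp [discriminant_apply, hreg.degree_eq, SimpleGraph.adjMatrix_apply,
    inv_sqrt_mul_inv_sqrt]

theorem spectrum_discriminant_subset (hreg : G.IsRegularOfDegree k)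
    (hspec : spectrum ℂ (G.adjMatrix ℂ) = {(k : ℂ), (k : ℂ) / 2, -((k : ℂ) / 2), 0}) :
    spectrum ℝ (discriminant G) ⊆ {1, 2⁻¹, -2⁻¹, 0} := by
  have hnonempty : (spectrum ℂ (G.adjMatrix ℂ)).Nonempty := hspec ▸ Set.insert_nonempty ..
  have : Nontrivial (Matrix V V ℂ) := by
    by_contra h
    rw [not_nontrivial_iff_subsingleton] at h
    exact hnonempty.ne_empty (spectrum.of_subsingleton _)
  intro c hc
  rw [← spectrum.algebraMap_mem_iff ℂ, discriminant_eq_smul_adjMatrix hreg,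
    spectrum.smul_eq_smul _ _ hnonempty, hspec] at hc
  obtain ⟨μ, hμ, hμc : (k : ℂ)⁻¹ • μ = (c : ℂ)⟩ := hc
  have hc : (c : ℂ) = (1 : ℝ) ∨ (c : ℂ) = (2⁻¹ : ℝ) ∨ (c : ℂ) = (-2⁻¹ : ℝ) ∨ (c : ℂ) = (0 : ℝ) := by
    by_cases hk : (k : ℂ) = 0 <;>
      rcases hμ with rfl | rfl | rfl | rfl <;> simp [← hμc, div_eq_mul_inv, hk]
  simpa only [Set.mem_insert_iff, Set.mem_singleton_iff, Complex.ofReal_inj] using hc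

end Regular

end GroverWalk

theorem mainTheorem9_general {V : Type*} [Fintype V] [DecidableEq V] (G : SimpleGraph V)
    [DecidableRel G.Adj] (hspec : spectrum ℝ (GroverWalk.discriminant G) ⊆ {1, 2⁻¹, -2⁻¹, 0})
    (hpst : GroverWalk.AdmitsPST G) :
    IsLeast (GroverWalk.pstTimes G) 6 ∧
    ∀ Φ Ψ : G.Dart → ℂ, GroverWalk.IsVertexTypeState G Φ → GroverWalk.IsVertexTypeState G Ψ →
      (∃ τ : ℕ, GroverWalk.PSTOccurs G Φ Ψ τ) →
        IsLeast {τ : ℕ | GroverWalk.PSTOccurs G Φ Ψ τ} 6 := by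
  refine ⟨⟨?_, ?_⟩, fun Φ Ψ hΦ hΨ ⟨τ, hτ⟩ => ⟨?_, fun σ hσ => ?_⟩⟩
  · obtain ⟨Φ, Ψ, hΦ, hΨ, τ, hτ⟩ := hpst
    exact ⟨Φ, Ψ, hΦ, hΨ, (GroverWalk.six_le_and_pstOccurs_six hspec hΦ hΨ hτ).2⟩
  · rintro τ ⟨Φ, Ψ, hΦ, hΨ, hτ⟩
    exact (GroverWalk.six_le_and_pstOccurs_six hspec hΦ hΨ hτ).1
  · exact (GroverWalk.six_le_and_pstOccurs_six hspec hΦ hΨ hτ).2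
  · exact (GroverWalk.six_le_and_pstOccurs_six hspec hΦ hΨ hσ).1

theorem mainTheorem9 {V : Type*} [Fintype V] [DecidableEq V] (G : SimpleGraph V)
    [DecidableRel G.Adj] (k : ℕ) (hconn : G.Connected) (hreg : G.IsRegularOfDegree k)
    (hspec : spectrum ℂ (G.adjMatrix ℂ) = {(k : ℂ), (k : ℂ) / 2, -((k : ℂ) / 2), 0})
    (hpst : GroverWalk.AdmitsPST G) :
    (IsLeast (GroverWalk.pstTimes G) 6 ∨ IsLeast (GroverWalk.pstTimes G) 12) ∧
    ∀ Φ Ψ : G.Dart → ℂ, GroverWalk.IsVertexTypeState G Φ → GroverWalk.IsVertexTypeState G Ψ →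
      (∃ τ : ℕ, GroverWalk.PSTOccurs G Φ Ψ τ) →
        (IsLeast {τ : ℕ | GroverWalk.PSTOccurs G Φ Ψ τ} 6 ∨
          IsLeast {τ : ℕ | GroverWalk.PSTOccurs G Φ Ψ τ} 12) := by
  have h := mainTheorem9_general G (GroverWalk.spectrum_discriminant_subset hreg hspec) hpst
  exact ⟨.inl h.1, fun Φ Ψ hΦ hΨ hτ => .inl (h.2 Φ Ψ hΦ hΨ hτ)⟩
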